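/- Let $G=(V,E)$ be a finite connected graph with $|V|\ge 2$; parallel edges are allowed, loops are not. A \emph{two-forest} of $G$ is a subgraph of $G$ that contains all vertices of $G$, contains no cycles, and has exactly two connected components. The \emph{cut set} $\partial F$ of a two-forest $F$ is the set of edges of $G$ that have one endpoint in each component of $F$. Let $\mathrm{avg.deg}=\frac1{|V|}\sum_{v\in V}\deg v$ be the average degree of $G$. Then $\mathrm{avg.deg}=2|E|/|V|$, the graph $G$ has at least one two-forest, and if $F$ is a two-forest of $G$ chosen uniformly at random, then \[ \mathbb{E}\bigl(|\partial F|\bigr)=\frac{\sum_{F}|\partial F|}{\#\{\text{two-forests of }G\}}\;\le\; 2\,(\mathrm{avg.deg})\left(1+\frac{1}{|V|-1}\right), \] where the sum runs over all two-forests $F$ of $G$. -/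

import Mathlib

namespace TwoForest

variable {α β : Type*}

/-- Two vertices are joined by a (possibly trivial) path of `G`. -/
def Reachable (G : Graph α β) : α → α → Prop :=
  Relation.ReflTransGen G.Adj

/-- A multigraph is connected if it has a vertex and any two of its vertices are joined
by a path. -/
def Connected (G : Graph α β) : Prop :=
  G.vertexSet.Nonempty ∧ ∀ u ∈ G.vertexSet, ∀ v ∈ G.vertexSet, Reachable G u v

/-- `G` contains a cycle: for some `n ≥ 0` there are `n + 1` distinct vertices
`v 0, …, v n` and `n + 1` distinct edges `e 0, …, e n` such that `e i` joins `v i` to `v (i + 1)`,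
indices being read modulo `n + 1`.  (A loop is a cycle with `n = 0`, and a pair of parallel edges
is a cycle with `n = 1`.) -/
def HasCycle (G : Graph α β) : Prop :=
  ∃ (n : ℕ) (v : Fin (n + 1) → α) (e : Fin (n + 1) → β),
    Function.Injective v ∧ Function.Injective e ∧ ∀ i, G.IsLink (e i) (v i) (v (i + 1))

/-- The vertex sets of the connected components of `G`. -/
def components (G : Graph α β) : Set (Set α) :=
  {C | ∃ x ∈ G.vertexSet, C = {y | Reachable G x y}}

/-- The two-forests of `G`: the subgraphs that contain all vertices of `G`, contain no cycles,
and have exactly two connected components. -/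
def twoForests (G : Graph α β) : Set (Graph α β) :=
  {F | F.IsSpanningSubgraph G ∧ ¬ HasCycle F ∧ (components F).ncard = 2}

/-- The cut set `∂F`: the edges of `G` whose endpoints lie in different components of `F`. -/
def cutSet (G F : Graph α β) : Set β :=
  {e | ∃ A ∈ components F, ∃ B ∈ components F, A ≠ B ∧ ∃ u ∈ A, ∃ v ∈ B, G.IsLink e u v}

/-- The expectation of `|∂F|` when `F` has the uniform distribution on the two-forests of `G`.
For a finite graph the sum and the cardinalities are those of finite sets,
see `twoForests_finite`. -/
noncomputable def expectedCutSize (G : Graph α β) : ℝ :=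
  (∑ᶠ F ∈ twoForests G, ((cutSet G F).ncard : ℝ)) / ((twoForests G).ncard : ℝ)

/-- The degree of a vertex of a graph without loops: the number of edges incident to it. -/
noncomputable def degree (G : Graph α β) (v : α) : ℕ :=
  {e | G.Inc e v}.ncard

/-- The average degree of the vertices of `G`. -/
noncomputable def avgDegree (G : Graph α β) : ℝ :=
  (∑ᶠ v ∈ G.vertexSet, (degree G v : ℝ)) / (G.vertexSet.ncard : ℝ)

/-- A graph with finitely many edges has finitely many two-forests. -/
theorem twoForests_finite (G : Graph α β) (hE : G.edgeSet.Finite) : (twoForests G).Finite := by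
  refine Set.Finite.of_finite_image (f := fun F : Graph α β => F.edgeSet)
    (hE.finite_subsets.subset ?_) ?_
  · rintro _ ⟨F, hF, rfl⟩
    exact hF.1.le.edgeSet_mono
  · intro F hF H hH h
    exact (Graph.Compatible.of_le_le hF.1.le hH.1.le).ext
      (hF.1.vertexSet_eq.trans hH.1.vertexSet_eq.symm) h

end TwoForest

/-!
Ground the graph at a vertex `x` and let `g` be the Green function of its Laplacian. Write `n` for
the number of vertices and `τ` for the number of spanning trees. By the matrix-tree theorem for
principal minors, `τ * g v v` counts the two-forests that separate `v` from `x`, and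
`τ * (g u u * g v v - g u v ^ 2)` counts the spanning forests with three components that separate
`u`, `v` and `x`. The component of a two-forest that avoids `x` has one more vertex than edges, and
removing one of its edges `uv` leaves such a three-component forest. Hence
`#two-forests / τ = ∑ v, g v v - ∑ uv, (g u u * g v v - g u v ^ 2)`, the second sum being over the
edges.

The Laplace equation also turns the first sum into a sum over edges, and then four times the summand
of an edge `uv` exceeds the square of its effective resistance `r = g u u + g v v - 2 * g u v` by
`3 * (g u u - g v v) ^ 2`. By Foster's theorem the effective resistances add up to `n - 1`, so the
Cauchy-Schwarz inequality gives `(n - 1) ^ 2 * τ ≤ 4 * #edges * #two-forests`.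

Finally, adding an edge of its cut set to a two-forest gives a spanning tree with a marked edge, and
this is a bijection, so the sizes of the cut sets add up to `(n - 1) * τ`.
-/

namespace TwoForest

open Finset Relation
open scoped Matrix

section Forests

variable {V E : Type*} (s t : E → V)

/-- The edge `e`, with ends `s e` and `t e`, joins `a` and `b`. A multigraph with vertex set `V` and
edge set `E` is encoded by the two ends `s e` and `t e` of each edge, listed in arbitrary order. -/
def Link (e : E) (a b : V) : Prop :=
  s e = a ∧ t e = b ∨ s e = b ∧ t e = a

/-- The vertices `a` and `b` are joined by a path with edges in `S`. -/
def JoinedBy (S : Finset E) : V → V → Prop :=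
  ReflTransGen fun a b => ∃ e ∈ S, Link s t e a b

noncomputable instance (S : Finset E) : DecidableRel (JoinedBy s t S) := Classical.decRel _

/-- Every vertex is joined by edges of `S` to a vertex of `R`. -/
def Spans (S : Finset E) (R : Finset V) : Prop :=
  ∀ v, ∃ r ∈ R, JoinedBy s t S v r

/-- `S` is a spanning forest each of whose components contains exactly one vertex of `R`. Given that
`S` spans `R`, the edge count expresses that `S` has no cycle and joins no two vertices of `R`. -/
def IsRootedForest [Fintype V] (S : Finset E) (R : Finset V) : Prop :=
  Spans s t S R ∧ #S + #R = Fintype.card V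

noncomputable instance [Fintype V] (S : Finset E) : DecidablePred (IsRootedForest s t S) :=
  Classical.decPred _

variable {s t}

theorem Link.symm {e : E} {a b : V} (h : Link s t e a b) : Link s t e b a := Or.symm h

theorem link_ends (e : E) : Link s t e (s e) (t e) := Or.inl ⟨rfl, rfl⟩

namespace JoinedBy

variable {S T : Finset E} {a b c : V}

theorem single {e : E} (he : e ∈ S) (h : Link s t e a b) : JoinedBy s t S a b :=
  ReflTransGen.single ⟨e, he, h⟩

theorem trans (hab : JoinedBy s t S a b) (hbc : JoinedBy s t S b c) : JoinedBy s t S a c :=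
  ReflTransGen.trans hab hbc

theorem symm (h : JoinedBy s t S a b) : JoinedBy s t S b a := by
  induction h with
  | refl => exact .refl
  | tail _ hl ih =>
    obtain ⟨e, he, hl⟩ := hl
    exact (single he hl.symm).trans ih

theorem mono (hST : S ⊆ T) (h : JoinedBy s t S a b) : JoinedBy s t T a b :=
  ReflTransGen.mono (fun _ _ ⟨e, he, hl⟩ => ⟨e, hST he, hl⟩) a b h

theorem erase [DecidableEq E] {e : E} (he : JoinedBy s t (S.erase e) (s e) (t e))
    (h : JoinedBy s t S a b) : JoinedBy s t (S.erase e) a b := by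
  induction h with
  | refl => exact .refl
  | tail _ hl ih =>
    obtain ⟨f, hf, hl⟩ := hl
    refine ih.trans ?_
    rcases eq_or_ne f e with rfl | hfe
    · rcases hl with ⟨rfl, rfl⟩ | ⟨rfl, rfl⟩
      exacts [he, he.symm]
    · exact single (mem_erase.2 ⟨hfe, hf⟩) hl

theorem filter (h : JoinedBy s t S a b) : JoinedBy s t {e ∈ S | JoinedBy s t S b (s e)} a b := by
  induction h using ReflTransGen.head_induction_on with
  | refl => exact .refl
  | head hl hcb ih =>
    obtain ⟨e, he, hl⟩ := hl
    have hbs : JoinedBy s t S b (s e) := by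
      have hbc := JoinedBy.symm hcb
      rcases hl with ⟨rfl, rfl⟩ | ⟨rfl, rfl⟩
      exacts [hbc.trans (single he (link_ends e).symm), hbc]
    exact (single (mem_filter.2 ⟨he, hbs⟩) hl).trans ih

end JoinedBy

namespace Spans

variable {S T : Finset E} {R Q : Finset V}

theorem mono (hST : S ⊆ T) (h : Spans s t S R) : Spans s t T R := fun v =>
  (h v).imp fun _ => And.imp_right (JoinedBy.mono hST)

theorem of_joinedBy (h : Spans s t S R) (hR : ∀ r ∈ R, ∃ q ∈ Q, JoinedBy s t S r q) :
    Spans s t S Q := fun v => by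
  obtain ⟨r, hr, hvr⟩ := h v
  obtain ⟨q, hq, hrq⟩ := hR r hr
  exact ⟨q, hq, hvr.trans hrq⟩

theorem mono_roots (hRQ : R ⊆ Q) (h : Spans s t S R) : Spans s t S Q :=
  h.of_joinedBy fun r hr => ⟨r, hRQ hr, .refl⟩

theorem exists_link (h : Spans s t S R) {v : V} (hv : v ∉ R) :
    ∃ e ∈ S, ∃ u ∈ R, ∃ w ∉ R, Link s t e u w := by
  obtain ⟨r, hr, hvr⟩ := h v
  induction hvr using ReflTransGen.head_induction_on with
  | refl => exact absurd hr hv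
  | @head a b hl _ ih =>
    obtain ⟨e, he, hl⟩ := hl
    by_cases hb : b ∈ R
    · exact ⟨e, he, b, hb, a, hv, hl.symm⟩
    · exact ih hb

theorem erase [DecidableEq E] {e : E} (hs : s e ∈ R) (ht : t e ∈ R) (h : Spans s t S R) :
    Spans s t (S.erase e) R := fun v => by
  obtain ⟨r, hr, hvr⟩ := h v
  induction hvr using ReflTransGen.head_induction_on with
  | refl => exact ⟨r, hr, .refl⟩
  | head hl _ ih =>
    obtain ⟨f, hf, hl⟩ := hl
    rcases eq_or_ne f e with rfl | hfe
    · rcases hl with ⟨rfl, -⟩ | ⟨-, rfl⟩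
      exacts [⟨_, hs, .refl⟩, ⟨_, ht, .refl⟩]
    · obtain ⟨q, hq, hj⟩ := ih
      exact ⟨q, hq, (JoinedBy.single (mem_erase.2 ⟨hfe, hf⟩) hl).trans hj⟩

end Spans

theorem spans_insert_iff [DecidableEq V] [DecidableEq E] {S : Finset E} {R : Finset V} {e : E}
    {u v : V} (hl : Link s t e u v) (hu : u ∈ R) :
    Spans s t (insert e S) R ↔ Spans s t S (insert v R) := by
  constructor
  · intro h
    have hends : s e ∈ insert v R ∧ t e ∈ insert v R := by
      rcases hl with ⟨rfl, rfl⟩ | ⟨rfl, rfl⟩ <;> simp [hu]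
    refine ((h.mono_roots (subset_insert v R)).erase hends.1 hends.2).mono ?_
    rw [erase_insert_eq_erase]
    exact erase_subset e S
  · refine fun h => (h.mono (subset_insert e S)).of_joinedBy fun r hr => ?_
    rcases mem_insert.1 hr with rfl | hr
    · exact ⟨u, hu, .single (mem_insert_self e S) hl.symm⟩
    · exact ⟨r, hr, .refl⟩

variable [Fintype V]

theorem isRootedForest_insert_iff [DecidableEq V] [DecidableEq E] {S : Finset E} {R : Finset V}
    {e : E} {u v : V} (hl : Link s t e u v) (hu : u ∈ R) (hv : v ∉ R) (he : e ∉ S) :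
    IsRootedForest s t (insert e S) R ↔ IsRootedForest s t S (insert v R) := by
  rw [IsRootedForest, IsRootedForest, spans_insert_iff hl hu, card_insert_of_notMem he,
    card_insert_of_notMem hv, add_right_comm, add_assoc]

theorem isRootedForest_univ_iff {S : Finset E} : IsRootedForest s t S univ ↔ S = ∅ := by
  rw [IsRootedForest, card_univ, Nat.add_eq_right, card_eq_zero]
  exact and_iff_right fun v => ⟨v, mem_univ v, .refl⟩

namespace Spans

variable {S : Finset E} {R : Finset V}

theorem exists_isRootedForest (h : Spans s t S R) : ∃ T ⊆ S, IsRootedForest s t T R := by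
  classical
  induction S using Finset.strongInduction generalizing R with
  | H S ih =>
    by_cases hR : R = univ
    · exact ⟨∅, empty_subset S, hR ▸ isRootedForest_univ_iff.2 rfl⟩
    · obtain ⟨v, hv⟩ := not_forall.1 (mt eq_univ_iff_forall.2 hR)
      obtain ⟨e, he, u, hu, w, hw, hl⟩ := h.exists_link hv
      rw [← insert_erase he, spans_insert_iff hl hu] at h
      obtain ⟨T, hTS, hT⟩ := ih (S.erase e) (erase_ssubset he) h
      have heT : e ∉ T := fun heT => notMem_erase e S (hTS heT)
      exact ⟨insert e T, insert_subset he (hTS.trans (erase_subset e S)),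
        (isRootedForest_insert_iff hl hu hw heT).2 hT⟩

theorem card_le (h : Spans s t S R) : Fintype.card V ≤ #S + #R := by
  obtain ⟨T, hTS, hT⟩ := h.exists_isRootedForest
  rw [← hT.2]
  gcongr

end Spans

theorem card_joinedBy_le (S : Finset E) (b : V) :
    #{v | JoinedBy s t S b v} ≤ #{e ∈ S | JoinedBy s t S b (s e)} + 1 := by
  classical
  -- The edges of the component of `b`, with `b` and all vertices outside it as roots, span.
  have hspan : Spans s t {e ∈ S | JoinedBy s t S b (s e)}
      (insert b ({v | ¬ JoinedBy s t S b v} : Finset V)) := fun v => by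
    by_cases hv : JoinedBy s t S b v
    · exact ⟨b, mem_insert_self _ _, hv.symm.filter⟩
    · exact ⟨v, mem_insert_of_mem (by simpa using hv), .refl⟩
  have hle := hspan.card_le
  have hsplit := card_filter_add_card_filter_not (s := (univ : Finset V)) (JoinedBy s t S b)
  have hins := card_insert_le b ({v | ¬ JoinedBy s t S b v} : Finset V)
  rw [card_univ] at hsplit
  lia

namespace IsRootedForest

variable {S : Finset E} {R Q : Finset V}

theorem not_joinedBy_erase [DecidableEq E] (h : IsRootedForest s t S R) {e : E} (he : e ∈ S) :
    ¬ JoinedBy s t (S.erase e) (s e) (t e) := fun hj => by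
  have hspan : Spans s t (S.erase e) R := fun v =>
    (h.1 v).imp fun _ => And.imp_right (JoinedBy.erase hj)
  have hle := hspan.card_le
  have hcard := card_erase_add_one he
  have := h.2
  lia

theorem eq_of_joinedBy (h : IsRootedForest s t S R) {a b : V} (ha : a ∈ R) (hb : b ∈ R)
    (hab : JoinedBy s t S a b) : a = b := by
  classical
  by_contra hne
  have hspan : Spans s t S (R.erase a) := h.1.of_joinedBy fun r hr => by
    rcases eq_or_ne r a with rfl | hra
    · exact ⟨b, mem_erase.2 ⟨Ne.symm hne, hb⟩, hab⟩
    · exact ⟨r, mem_erase.2 ⟨hra, hr⟩, .refl⟩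
  have hle := hspan.card_le
  have hcard := card_erase_add_one ha
  have := h.2
  lia

theorem notMem (h : IsRootedForest s t S R) {e : E} {u v : V} (hl : Link s t e u v) (hu : u ∈ R)
    (hv : v ∈ R) (huv : u ≠ v) : e ∉ S := fun he =>
  huv (h.eq_of_joinedBy hu hv (.single he hl))

theorem of_joinedBy (h : IsRootedForest s t S R) (hR : ∀ r ∈ R, ∃ q ∈ Q, JoinedBy s t S r q)
    (hcard : #Q = #R) : IsRootedForest s t S Q :=
  ⟨h.1.of_joinedBy hR, hcard ▸ h.2⟩

end IsRootedForest

theorem isRootedForest_of_bridges [DecidableEq E] {S : Finset E} {R : Finset V}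
    (h : Spans s t S R) (hR : ∀ a ∈ R, ∀ b ∈ R, JoinedBy s t S a b → a = b)
    (hS : ∀ e ∈ S, ¬ JoinedBy s t (S.erase e) (s e) (t e)) : IsRootedForest s t S R := by
  obtain ⟨T, hTS, hT⟩ := h.exists_isRootedForest
  suffices T = S from this ▸ hT
  refine hTS.antisymm fun e he => ?_
  by_contra heT
  obtain ⟨a, ha, hsa⟩ := hT.1 (s e)
  obtain ⟨b, hb, htb⟩ := hT.1 (t e)
  obtain rfl := hR a ha b hb
    (((hsa.mono hTS).symm.trans (.single he (link_ends e))).trans (htb.mono hTS))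
  exact hS e he ((hsa.trans htb.symm).mono (subset_erase.2 ⟨hTS, heT⟩))

variable (s t) in
/-- `S` is the edge set of a two-forest: a spanning forest with exactly two components. -/
def IsTwoForest [DecidableEq V] (S : Finset E) : Prop :=
  ∃ u v, u ≠ v ∧ IsRootedForest s t S {u, v}

noncomputable instance [DecidableEq V] : DecidablePred (IsTwoForest s t) := Classical.decPred _

theorem isTwoForest_iff [DecidableEq V] [DecidableEq E] {S : Finset E} : IsTwoForest s t S ↔
    (∃ u v, ¬ JoinedBy s t S u v ∧ ∀ w, JoinedBy s t S w u ∨ JoinedBy s t S w v) ∧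
      ∀ e ∈ S, ¬ JoinedBy s t (S.erase e) (s e) (t e) := by
  constructor
  · rintro ⟨u, v, huv, h⟩
    refine ⟨⟨u, v, mt (h.eq_of_joinedBy (by simp) (by simp)) huv, fun w => ?_⟩,
      fun e => h.not_joinedBy_erase⟩
    simpa using h.1 w
  · rintro ⟨⟨u, v, huv, h⟩, hS⟩
    refine ⟨u, v, fun hne => huv (hne ▸ .refl), isRootedForest_of_bridges ?_ ?_ hS⟩
    · simpa [Spans] using h
    · simp only [mem_insert, mem_singleton]
      rintro a (rfl | rfl) b (rfl | rfl) hab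
      exacts [rfl, absurd hab huv, absurd hab.symm huv, rfl]

namespace IsTwoForest

variable [DecidableEq V] {F : Finset E}

theorem isRootedForest_pair_iff (hF : IsTwoForest s t F) {u v : V} :
    u ≠ v ∧ IsRootedForest s t F {u, v} ↔ ¬ JoinedBy s t F u v := by
  constructor
  · rintro ⟨huv, h⟩ hj
    exact huv (h.eq_of_joinedBy (by simp) (by simp) hj)
  · intro hj
    obtain ⟨a, b, hab, h⟩ := hF
    have huv : u ≠ v := by rintro rfl; exact hj .refl
    refine ⟨huv, h.of_joinedBy (fun r hr => ?_) (by rw [card_pair huv, card_pair hab])⟩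
    obtain ⟨p, hp, hup⟩ := h.1 u
    obtain ⟨q, hq, hvq⟩ := h.1 v
    have hpq : p ≠ q := by rintro rfl; exact hj (hup.trans hvq.symm)
    have hr : r = p ∨ r = q := by grind
    rcases hr with rfl | rfl
    · exact ⟨u, by simp, hup.symm⟩
    · exact ⟨v, by simp, hvq.symm⟩

theorem card_not_joinedBy (hF : IsTwoForest s t F) (x : V) :
    #{v | ¬ JoinedBy s t F x v} = #{e ∈ F | ¬ JoinedBy s t F x (s e)} + 1 := by
  obtain ⟨v₀, hv₀⟩ : ∃ v₀, ¬ JoinedBy s t F x v₀ := by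
    obtain ⟨a, b, hab, h⟩ := hF
    by_contra! hall
    exact hab (h.eq_of_joinedBy (by simp) (by simp) ((hall a).symm.trans (hall b)))
  obtain ⟨hne, h⟩ := hF.isRootedForest_pair_iff.2 hv₀
  have hiff (v : V) : ¬ JoinedBy s t F x v ↔ JoinedBy s t F v₀ v := by
    refine ⟨fun hv => ?_, fun hv hxv => hv₀ (hxv.trans hv.symm)⟩
    obtain ⟨r, hr, hj⟩ := h.1 v
    rcases mem_insert.1 hr with rfl | hr
    · exact absurd hj.symm hv
    · exact mem_singleton.1 hr ▸ hj.symm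
  have hx := card_joinedBy_le (s := s) (t := t) F x
  have hv := card_joinedBy_le (s := s) (t := t) F v₀
  have hV := card_filter_add_card_filter_not (s := (univ : Finset V)) (JoinedBy s t F x)
  have hE := card_filter_add_card_filter_not (s := F) fun e => JoinedBy s t F x (s e)
  have hcard := h.2
  rw [card_pair hne] at hcard
  rw [card_univ] at hV
  simp only [hiff] at hV hE ⊢
  lia

end IsTwoForest

section Counting

variable (s t)

/-- The forests contained in `S` with exactly one root from `R` in each component. -/
noncomputable def rootedForests (S : Finset E) (R : Finset V) : Finset (Finset E) :=
  {T ∈ S.powerset | IsRootedForest s t T R}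

/-- The edge sets of the two-forests. -/
noncomputable def twoForestFinset [DecidableEq V] [Fintype E] : Finset (Finset E) :=
  {F | IsTwoForest s t F}

variable {s t}

theorem mem_rootedForests {S T : Finset E} {R : Finset V} :
    T ∈ rootedForests s t S R ↔ T ⊆ S ∧ IsRootedForest s t T R := by
  rw [rootedForests, mem_filter, mem_powerset]

theorem rootedForests_univ_right (S : Finset E) : rootedForests s t S univ = {∅} := by
  ext T
  rw [mem_rootedForests, isRootedForest_univ_iff, mem_singleton]
  exact and_iff_right_of_imp fun h => h ▸ empty_subset S

theorem rootedForests_eq_empty {S : Finset E} {R : Finset V} (hR : R ≠ univ)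
    (h : ∀ e ∈ S, ∀ u ∈ R, ∀ v ∉ R, ¬ Link s t e u v) : rootedForests s t S R = ∅ := by
  refine eq_empty_of_forall_notMem fun T hT => ?_
  obtain ⟨hTS, hT⟩ := mem_rootedForests.1 hT
  obtain ⟨v, hv⟩ := not_forall.1 (mt eq_univ_iff_forall.2 hR)
  obtain ⟨e, he, u, hu, w, hw, hl⟩ := hT.1.exists_link hv
  exact h e (hTS he) u hu w hw hl

theorem card_filter_mem_rootedForests [DecidableEq V] [DecidableEq E] {S : Finset E}
    {R : Finset V} {e : E} {u v : V} (he : e ∈ S) (hl : Link s t e u v) (hu : u ∈ R)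
    (hv : v ∉ R) : #{T ∈ rootedForests s t S R | e ∈ T} = #(rootedForests s t S (insert v R)) := by
  have notMem_of_mem {T : Finset E} (hT : T ∈ rootedForests s t S (insert v R)) : e ∉ T :=
    (mem_rootedForests.1 hT).2.notMem hl (mem_insert_of_mem hu) (mem_insert_self v R)
      (ne_of_mem_of_not_mem hu hv)
  refine card_nbij' (·.erase e) (insert e) (fun T hT => ?_) (fun T hT => ?_)
    (fun T hT => insert_erase (mem_filter.1 hT).2) (fun T hT => erase_insert (notMem_of_mem hT))
  · obtain ⟨hT, heT⟩ := mem_filter.1 hT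
    obtain ⟨hTS, hT⟩ := mem_rootedForests.1 hT
    refine mem_rootedForests.2 ⟨(erase_subset e T).trans hTS, ?_⟩
    rwa [← isRootedForest_insert_iff hl hu hv (notMem_erase e T), insert_erase heT]
  · obtain ⟨hTS, hF⟩ := mem_rootedForests.1 hT
    exact mem_filter.2 ⟨mem_rootedForests.2 ⟨insert_subset he hTS,
      (isRootedForest_insert_iff hl hu hv (notMem_of_mem hT)).2 hF⟩, mem_insert_self e T⟩

theorem card_rootedForests_eq_add [DecidableEq V] [DecidableEq E] {S : Finset E} {R : Finset V}
    {e : E} {u v : V} (he : e ∈ S) (hl : Link s t e u v) (hu : u ∈ R) (hv : v ∉ R) :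
    #(rootedForests s t S R) = #(rootedForests s t (S.erase e) R) +
      #(rootedForests s t (S.erase e) (insert v R)) := by
  have hdel : {T ∈ rootedForests s t S R | e ∉ T} = rootedForests s t (S.erase e) R := by
    ext T
    rw [mem_filter, mem_rootedForests, mem_rootedForests, subset_erase, and_right_comm]
  have hcontr : rootedForests s t S (insert v R) = rootedForests s t (S.erase e) (insert v R) := by
    ext T
    rw [mem_rootedForests, mem_rootedForests, subset_erase]
    refine and_congr_left fun hT => (and_iff_left ?_).symm
    exact hT.notMem hl (mem_insert_of_mem hu) (mem_insert_self v R) (ne_of_mem_of_not_mem hu hv)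
  rw [← card_filter_add_card_filter_not (s := rootedForests s t S R) (e ∈ ·), hdel,
    card_filter_mem_rootedForests he hl hu hv, hcontr, add_comm]

theorem rootedForests_singleton_eq (S : Finset E) (x y : V) :
    rootedForests s t S {x} = rootedForests s t S {y} := by
  have of_singleton (a b : V) {T : Finset E} (h : IsRootedForest s t T {a}) :
      IsRootedForest s t T {b} := by
    refine h.of_joinedBy (fun r hr => ⟨b, mem_singleton_self b, ?_⟩) rfl
    obtain ⟨q, hq, hb⟩ := h.1 b
    rw [mem_singleton.1 hr, ← mem_singleton.1 hq]
    exact hb.symm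
  ext T
  rw [mem_rootedForests, mem_rootedForests]
  exact and_congr_right fun _ => ⟨of_singleton x y, of_singleton y x⟩

variable [DecidableEq V] [Fintype E]

theorem mem_twoForestFinset {F : Finset E} : F ∈ twoForestFinset s t ↔ IsTwoForest s t F :=
  mem_filter_univ F

theorem filter_not_joinedBy_twoForestFinset {u v : V} (huv : u ≠ v) :
    {F ∈ twoForestFinset s t | ¬ JoinedBy s t F u v} = rootedForests s t univ {u, v} := by
  ext F
  rw [mem_filter, mem_twoForestFinset, mem_rootedForests]
  constructor
  · rintro ⟨hF, hj⟩
    exact ⟨subset_univ F, (hF.isRootedForest_pair_iff.2 hj).2⟩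
  · rintro ⟨-, h⟩
    have hF : IsTwoForest s t F := ⟨u, v, huv, h⟩
    exact ⟨hF, hF.isRootedForest_pair_iff.1 ⟨huv, h⟩⟩

theorem sum_card_rootedForests_pair (x : V) :
    ∑ v ∈ univ.erase x, #(rootedForests s t univ {x, v}) =
      ∑ F ∈ twoForestFinset s t, #{v | ¬ JoinedBy s t F x v} := by
  refine Eq.trans ?_ (sum_card_bipartiteAbove_eq_sum_card_bipartiteBelow
    (t := twoForestFinset s t) fun v F => ¬ JoinedBy s t F x v)
  refine (sum_congr rfl fun v hv => ?_).trans (sum_erase univ ?_)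
  · rw [bipartiteAbove, filter_not_joinedBy_twoForestFinset (ne_of_mem_erase hv).symm]
  · exact card_eq_zero.2 (filter_eq_empty_iff.2 fun F _ => not_not.2 .refl)

theorem sum_card_rootedForests_triple (hst : ∀ e, s e ≠ t e) (x : V) :
    ∑ e with s e ≠ x ∧ t e ≠ x, #(rootedForests s t univ {x, s e, t e}) =
      ∑ F ∈ twoForestFinset s t, #{e ∈ F | ¬ JoinedBy s t F x (s e)} := by
  classical
  have hterm (e : E) (he : s e ≠ x ∧ t e ≠ x) : #(rootedForests s t univ {x, s e, t e}) =
      #{F ∈ twoForestFinset s t | ¬ JoinedBy s t F x (s e) ∧ e ∈ F} := by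
    rw [← filter_filter, filter_not_joinedBy_twoForestFinset he.1.symm,
      card_filter_mem_rootedForests (mem_univ e) (link_ends e) (by simp)
        (by simp [he.2, (hst e).symm])]
    congr 2
    grind
  have hzero (e : E) (he : ¬ (s e ≠ x ∧ t e ≠ x)) :
      {F ∈ twoForestFinset s t | ¬ JoinedBy s t F x (s e) ∧ e ∈ F} = ∅ := by
    refine filter_eq_empty_iff.2 fun F _ ⟨hj, heF⟩ => he ⟨?_, ?_⟩
    · rintro rfl
      exact hj .refl
    · rintro rfl
      exact hj (.single heF (link_ends e).symm)
  calc ∑ e with s e ≠ x ∧ t e ≠ x, #(rootedForests s t univ {x, s e, t e})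
      = ∑ e, #{F ∈ twoForestFinset s t | ¬ JoinedBy s t F x (s e) ∧ e ∈ F} := by
        rw [sum_filter]
        refine sum_congr rfl fun e _ => ?_
        split_ifs with he
        exacts [hterm e he, (card_eq_zero.2 (hzero e he)).symm]
    _ = ∑ F ∈ twoForestFinset s t, #{e | ¬ JoinedBy s t F x (s e) ∧ e ∈ F} :=
        sum_card_bipartiteAbove_eq_sum_card_bipartiteBelow _
    _ = ∑ F ∈ twoForestFinset s t, #{e ∈ F | ¬ JoinedBy s t F x (s e)} := by
        simp only [and_comm, ← filter_filter, filter_univ_mem]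

theorem card_twoForestFinset_add_sum (hst : ∀ e, s e ≠ t e) (x : V) :
    #(twoForestFinset s t) +
        ∑ e with s e ≠ x ∧ t e ≠ x, #(rootedForests s t univ {x, s e, t e}) =
      ∑ v ∈ univ.erase x, #(rootedForests s t univ {x, v}) := by
  rw [sum_card_rootedForests_triple hst, sum_card_rootedForests_pair, card_eq_sum_ones,
    ← sum_add_distrib]
  refine sum_congr rfl fun F hF => ?_
  rw [(mem_twoForestFinset.1 hF).card_not_joinedBy x, add_comm]

theorem sum_card_not_joinedBy_twoForestFinset (hst : ∀ e, s e ≠ t e) (x : V) :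
    ∑ F ∈ twoForestFinset s t, #{e | ¬ JoinedBy s t F (s e) (t e)} =
      (Fintype.card V - 1) * #(rootedForests s t univ {x}) := by
  classical
  have hedge (e : E) : #{F ∈ twoForestFinset s t | ¬ JoinedBy s t F (s e) (t e)} =
      #{T ∈ rootedForests s t univ {x} | e ∈ T} := by
    rw [filter_not_joinedBy_twoForestFinset (hst e), rootedForests_singleton_eq univ x (s e),
      card_filter_mem_rootedForests (mem_univ e) (link_ends e) (mem_singleton_self _)
        (notMem_singleton.2 (hst e).symm), pair_comm]
  have htree (T : Finset E) (hT : T ∈ rootedForests s t univ {x}) :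
      #{e | e ∈ T} = Fintype.card V - 1 := by
    rw [filter_univ_mem, ← (mem_rootedForests.1 hT).2.2, card_singleton, Nat.add_sub_cancel]
  calc ∑ F ∈ twoForestFinset s t, #{e | ¬ JoinedBy s t F (s e) (t e)}
      = ∑ e, #{F ∈ twoForestFinset s t | ¬ JoinedBy s t F (s e) (t e)} :=
        sum_card_bipartiteAbove_eq_sum_card_bipartiteBelow fun F e => ¬ JoinedBy s t F (s e) (t e)
    _ = ∑ e, #{T ∈ rootedForests s t univ {x} | e ∈ T} := sum_congr rfl fun e _ => hedge e
    _ = ∑ T ∈ rootedForests s t univ {x}, #{e | e ∈ T} :=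
        sum_card_bipartiteAbove_eq_sum_card_bipartiteBelow _
    _ = (Fintype.card V - 1) * #(rootedForests s t univ {x}) := by
        rw [sum_congr rfl htree, sum_const, smul_eq_mul, mul_comm]

end Counting

end Forests

section MatrixTree

variable {V E : Type*} [DecidableEq V] (s t : E → V)

/-- The row of the incidence matrix that belongs to the edge `e`. -/
def incidence (e : E) : V → ℝ :=
  Pi.single (s e) 1 - Pi.single (t e) 1

/-- The Laplacian of the graph with edge set `S`, with the rows of the vertices of `R` replaced by
those of the identity matrix. Its determinant is the principal minor of the Laplacian obtained by
deleting the rows and columns of `R`; keeping the size fixed avoids a change of index type. -/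
def groundedLaplacian (S : Finset E) (R : Finset V) : Matrix V V ℝ :=
  Matrix.of fun a => if a ∈ R then Pi.single a 1 else ∑ e ∈ S, incidence s t e a • incidence s t e

variable {s t}

theorem incidence_eq_zero {e : E} {u v a : V} (hl : Link s t e u v) (hu : a ≠ u) (hv : a ≠ v) :
    incidence s t e a = 0 := by
  rcases hl with ⟨rfl, rfl⟩ | ⟨rfl, rfl⟩ <;> simp [incidence, hu, hv]

theorem incidence_smul_incidence {e : E} {u v : V} (hl : Link s t e u v) (huv : u ≠ v) :
    incidence s t e v • incidence s t e = Pi.single v 1 - Pi.single u 1 := by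
  rcases hl with ⟨rfl, rfl⟩ | ⟨rfl, rfl⟩ <;> simp [incidence, huv.symm]

theorem groundedLaplacian_apply_of_mem (S : Finset E) {R : Finset V} {a : V} (ha : a ∈ R) :
    groundedLaplacian s t S R a = Pi.single a 1 :=
  if_pos ha

theorem groundedLaplacian_apply_of_notMem (S : Finset E) {R : Finset V} {a : V} (ha : a ∉ R) :
    groundedLaplacian s t S R a = ∑ e ∈ S, incidence s t e a • incidence s t e :=
  if_neg ha

theorem groundedLaplacian_insert (S : Finset E) (R : Finset V) (v : V) :
    groundedLaplacian s t S (insert v R) =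
      (groundedLaplacian s t S R).updateRow v (Pi.single v 1) := by
  refine funext fun a => ?_
  rcases eq_or_ne a v with rfl | hav
  · rw [Matrix.updateRow_self, groundedLaplacian_apply_of_mem S (mem_insert_self a R)]
  · rw [Matrix.updateRow_ne hav]
    exact if_congr (mem_insert.trans (or_iff_right hav)) rfl rfl

theorem groundedLaplacian_eq_updateRow_erase [DecidableEq E] {S : Finset E} {R : Finset V} {e : E}
    {u v : V} (he : e ∈ S) (hl : Link s t e u v) (hu : u ∈ R) (hv : v ∉ R) :
    groundedLaplacian s t S R = (groundedLaplacian s t (S.erase e) R).updateRow v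
      (groundedLaplacian s t (S.erase e) R v + (Pi.single v 1 - Pi.single u 1)) := by
  refine funext fun a => ?_
  rcases eq_or_ne a v with rfl | hav
  · rw [Matrix.updateRow_self, groundedLaplacian_apply_of_notMem S hv,
      groundedLaplacian_apply_of_notMem _ hv, ← sum_erase_add S _ he,
      incidence_smul_incidence hl (ne_of_mem_of_not_mem hu hv)]
  · rw [Matrix.updateRow_ne hav]
    by_cases ha : a ∈ R
    · rw [groundedLaplacian_apply_of_mem _ ha, groundedLaplacian_apply_of_mem _ ha]
    · rw [groundedLaplacian_apply_of_notMem _ ha, groundedLaplacian_apply_of_notMem _ ha,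
        ← sum_erase_add S _ he,
        incidence_eq_zero hl (ne_of_mem_of_not_mem hu ha).symm hav, zero_smul, add_zero]

variable [Fintype V]

theorem incidence_dotProduct (e : E) (f : V → ℝ) : incidence s t e ⬝ᵥ f = f (s e) - f (t e) := by
  rw [incidence, sub_dotProduct, single_one_dotProduct, single_one_dotProduct]

theorem groundedLaplacian_mulVec (S : Finset E) (R : Finset V) (f : V → ℝ) (a : V) :
    (groundedLaplacian s t S R *ᵥ f) a =
      if a ∈ R then f a else ∑ e ∈ S, incidence s t e a * (f (s e) - f (t e)) := by
  rw [Matrix.mulVec]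
  split_ifs with ha
  · rw [groundedLaplacian_apply_of_mem S ha, single_one_dotProduct]
  · simp only [groundedLaplacian_apply_of_notMem S ha, sum_dotProduct, smul_dotProduct,
      incidence_dotProduct, smul_eq_mul]

theorem groundedLaplacian_univ_right (S : Finset E) :
    groundedLaplacian s t S (univ : Finset V) = 1 := by
  ext a b
  rw [groundedLaplacian_apply_of_mem S (mem_univ a), Matrix.one_eq_pi_single]

theorem det_groundedLaplacian_eq_zero {S : Finset E} {R : Finset V} (hR : R ≠ univ)
    (h : ∀ e ∈ S, ∀ u ∈ R, ∀ v ∉ R, ¬ Link s t e u v) : (groundedLaplacian s t S R).det = 0 := by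
  obtain ⟨v, hv⟩ := not_forall.1 (mt eq_univ_iff_forall.2 hR)
  -- The indicator function of the complement of `R` is in the kernel.
  refine Matrix.exists_mulVec_eq_zero_iff.1 ⟨fun a => if a ∈ R then 0 else 1, fun h0 => ?_, ?_⟩
  · simpa [hv] using congrFun h0 v
  · refine funext fun a => ?_
    rw [groundedLaplacian_mulVec]
    split_ifs with ha
    · rfl
    · refine sum_eq_zero fun e he => ?_
      have hends : s e ∈ R ↔ t e ∈ R :=
        ⟨fun hs => by_contra fun ht => h e he _ hs _ ht (link_ends e),
          fun ht => by_contra fun hs => h e he _ ht _ hs (link_ends e).symm⟩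
      simp only [hends, sub_self, mul_zero]

theorem det_groundedLaplacian_eq_add [DecidableEq E] {S : Finset E} {R : Finset V} {e : E}
    {u v : V} (he : e ∈ S) (hl : Link s t e u v) (hu : u ∈ R) (hv : v ∉ R) :
    (groundedLaplacian s t S R).det = (groundedLaplacian s t (S.erase e) R).det +
      (groundedLaplacian s t (S.erase e) (insert v R)).det := by
  have huv : u ≠ v := ne_of_mem_of_not_mem hu hv
  rw [groundedLaplacian_eq_updateRow_erase he hl hu hv, groundedLaplacian_insert]
  set M := groundedLaplacian s t (S.erase e) R with hM
  have hu_row : M.updateRow v (Pi.single v 1) u = Pi.single u 1 := by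
    rw [Matrix.updateRow_ne huv, hM, groundedLaplacian_apply_of_mem _ hu]
  have hsub : (M.updateRow v (Pi.single v 1 - Pi.single u 1)).det =
      (M.updateRow v (Pi.single v 1)).det := by
    rw [← Matrix.det_updateRow_add_smul_self (M.updateRow v (Pi.single v 1)) huv.symm (-1),
      hu_row, Matrix.updateRow_self, Matrix.updateRow_idem, neg_one_smul, ← sub_eq_add_neg]
  rw [Matrix.det_updateRow_add, Matrix.updateRow_eq_self, hsub]

/-- The matrix-tree theorem for principal minors: both sides satisfy the same deletion-contraction
recursion. -/
theorem det_groundedLaplacian (S : Finset E) (R : Finset V) :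
    (groundedLaplacian s t S R).det = #(rootedForests s t S R) := by
  classical
  induction S using Finset.strongInduction generalizing R with
  | H S ih =>
    by_cases hR : R = univ
    · rw [hR, groundedLaplacian_univ_right, rootedForests_univ_right, Matrix.det_one,
        card_singleton, Nat.cast_one]
    by_cases h : ∀ e ∈ S, ∀ u ∈ R, ∀ v ∉ R, ¬ Link s t e u v
    · rw [det_groundedLaplacian_eq_zero hR h, rootedForests_eq_empty hR h, card_empty,
        Nat.cast_zero]
    · push Not at h
      obtain ⟨e, he, u, hu, v, hv, hl⟩ := h
      rw [det_groundedLaplacian_eq_add he hl hu hv, card_rootedForests_eq_add he hl hu hv,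
        ih _ (erase_ssubset he), ih _ (erase_ssubset he), Nat.cast_add]

end MatrixTree

section RowReplacement

variable {n R : Type*} [Fintype n] [DecidableEq n] [CommRing R]

theorem det_one_updateRow_updateRow {u v : n} (huv : u ≠ v) (a b : n → R) :
    (((1 : Matrix n n R).updateRow u a).updateRow v b).det = a u * b v - a v * b u := by
  let P : Matrix n (Fin 2) R := Matrix.of fun w => ![(1 : Matrix n n R) w u, (1 : Matrix n n R) w v]
  let Q : Matrix (Fin 2) n R := Matrix.of ![a - Pi.single u 1, b - Pi.single v 1]
  have hPQ : ((1 : Matrix n n R).updateRow u a).updateRow v b = 1 + P * Q := by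
    ext c d
    rw [Matrix.add_apply, Matrix.mul_apply, Fin.sum_univ_two]
    rcases eq_or_ne c v with rfl | hcv
    · simp [P, Q, huv.symm, Matrix.one_eq_pi_single]
    rcases eq_or_ne c u with rfl | hcu
    · simp [P, Q, huv, Matrix.one_eq_pi_single]
    · simp [P, Q, hcu, hcv]
  have hQP : 1 + Q * P = !![a u, a v; b u, b v] := by
    ext i j
    rw [Matrix.add_apply, Matrix.mul_apply]
    fin_cases i <;> fin_cases j <;> simp [P, Q, Matrix.one_apply, huv, huv.symm]
  rw [hPQ, Matrix.det_one_add_mul_comm, hQP, Matrix.det_fin_two_of]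

variable {A : Matrix n n R} (hA : IsUnit A.det)
include hA

theorem det_updateRow_single (v : n) : (A.updateRow v (Pi.single v 1)).det = A.det * A⁻¹ v v := by
  rw [Matrix.inv_def, Matrix.smul_apply, Matrix.adjugate_apply, smul_eq_mul, ← mul_assoc,
    Ring.mul_inverse_cancel _ hA, one_mul]

theorem det_updateRow_single_updateRow_single {u v : n} (huv : u ≠ v) :
    ((A.updateRow u (Pi.single u 1)).updateRow v (Pi.single v 1)).det =
      A.det * (A⁻¹ u u * A⁻¹ v v - A⁻¹ u v * A⁻¹ v u) := by
  have hmul : (A.updateRow u (Pi.single u 1)).updateRow v (Pi.single v 1) * A⁻¹ =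
      ((1 : Matrix n n R).updateRow u (A⁻¹.row u)).updateRow v (A⁻¹.row v) := by
    rw [Matrix.updateRow_mul, Matrix.updateRow_mul, Matrix.mul_nonsing_inv A hA,
      Matrix.single_one_vecMul, Matrix.single_one_vecMul]
  have hdet := det_one_updateRow_updateRow huv (A⁻¹.row u) (A⁻¹.row v)
  simp only [Matrix.row_apply] at hdet
  rw [← hdet, ← hmul, mul_comm, ← Matrix.det_mul, Matrix.nonsing_inv_mul_cancel_right A _ hA]

end RowReplacement

section GreenFunction

variable {V E : Type*} [Fintype V] [DecidableEq V] [Fintype E] (s t : E → V)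

/-- The Green function of the graph Laplacian grounded at `x`: the potential at `u` when a unit
current enters at `v` and leaves at `x`. It is a genuine inverse only if the graph is connected,
which is expressed below by the existence of a spanning tree. -/
noncomputable def greenFunction (x u v : V) : ℝ :=
  if v = x then 0 else (groundedLaplacian s t univ {x})⁻¹ u v

/-- The effective resistance between the ends of the edge `e`. The vertex `x` at which the Green
function is grounded only serves to express it. -/
noncomputable def effectiveResistance (x : V) (e : E) : ℝ :=
  greenFunction s t x (s e) (s e) + greenFunction s t x (t e) (t e) -
    2 * greenFunction s t x (s e) (t e)

variable {s t}

theorem greenFunction_right_self (x u : V) : greenFunction s t x u x = 0 :=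
  if_pos rfl

theorem greenFunction_of_ne {x v : V} (hv : v ≠ x) (u : V) :
    greenFunction s t x u v = (groundedLaplacian s t univ {x})⁻¹ u v :=
  if_neg hv

variable {x : V} (hx : (rootedForests s t univ {x}).Nonempty)
include hx

theorem isUnit_det_groundedLaplacian : IsUnit (groundedLaplacian s t univ {x}).det := by
  rw [det_groundedLaplacian, isUnit_iff_ne_zero, Nat.cast_ne_zero]
  exact hx.card_ne_zero

theorem groundedLaplacian_mulVec_greenFunction {v : V} (hv : v ≠ x) (a : V) :
    (groundedLaplacian s t univ {x} *ᵥ (greenFunction s t x · v)) a = if a = v then 1 else 0 := by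
  rw [← Matrix.one_apply, ← Matrix.mul_nonsing_inv _ (isUnit_det_groundedLaplacian hx),
    Matrix.mul_apply_eq_vecMul]
  simp only [greenFunction_of_ne hv]
  rfl

theorem greenFunction_left_self (v : V) : greenFunction s t x x v = 0 := by
  rcases eq_or_ne v x with rfl | hv
  · exact greenFunction_right_self _ _
  · have h := groundedLaplacian_mulVec_greenFunction hx hv x
    rwa [groundedLaplacian_mulVec, if_pos (mem_singleton_self x), if_neg hv.symm] at h

theorem sum_incidence_mul_greenFunction {a : V} (ha : a ≠ x) (v : V) :
    ∑ e, incidence s t e a * (greenFunction s t x (s e) v - greenFunction s t x (t e) v) =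
      if a = v then 1 else 0 := by
  rcases eq_or_ne v x with rfl | hv
  · simp only [greenFunction_right_self, sub_self, mul_zero, sum_const_zero, if_neg ha]
  · rw [← groundedLaplacian_mulVec_greenFunction hx hv a, groundedLaplacian_mulVec,
      if_neg (notMem_singleton.2 ha)]

theorem sum_sub_mul_greenFunction_sub {f : V → ℝ} (hf : f x = 0) (v : V) :
    ∑ e, (f (s e) - f (t e)) * (greenFunction s t x (s e) v - greenFunction s t x (t e) v) =
      f v := by
  have hterm (a : V) : f a * ∑ e, incidence s t e a *
      (greenFunction s t x (s e) v - greenFunction s t x (t e) v) = if a = v then f a else 0 := by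
    rcases eq_or_ne a x with rfl | ha
    · rw [hf, zero_mul, ite_self]
    · rw [sum_incidence_mul_greenFunction hx ha, mul_ite, mul_one, mul_zero]
  rw [← Fintype.sum_ite_eq' v f, ← sum_congr rfl fun a _ => hterm a]
  simp only [mul_sum]
  rw [sum_comm]
  refine sum_congr rfl fun e _ => ?_
  rw [← incidence_dotProduct, dotProduct, sum_mul]
  exact sum_congr rfl fun a _ => by ring

theorem greenFunction_comm (u v : V) : greenFunction s t x u v = greenFunction s t x v u := by
  rw [← sum_sub_mul_greenFunction_sub hx (f := (greenFunction s t x · v))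
      (greenFunction_left_self hx v) u,
    ← sum_sub_mul_greenFunction_sub hx (f := (greenFunction s t x · u))
      (greenFunction_left_self hx u) v]
  exact sum_congr rfl fun e _ => mul_comm _ _

theorem card_mul_greenFunction_self {v : V} (hv : v ≠ x) :
    #(rootedForests s t univ {x}) * greenFunction s t x v v =
      #(rootedForests s t univ {x, v}) := by
  rw [pair_comm, ← det_groundedLaplacian, ← det_groundedLaplacian, groundedLaplacian_insert,
    det_updateRow_single (isUnit_det_groundedLaplacian hx), greenFunction_of_ne hv]

theorem card_mul_greenFunction_minor {u v : V} (hu : u ≠ x) (hv : v ≠ x) (huv : u ≠ v) :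
    #(rootedForests s t univ {x}) * (greenFunction s t x u u * greenFunction s t x v v -
      greenFunction s t x u v ^ 2) = #(rootedForests s t univ {x, u, v}) := by
  have hinsert : ({x, u, v} : Finset V) = insert v {u, x} := by grind
  rw [hinsert, sq]
  nth_rw 4 [greenFunction_comm hx]
  rw [← det_groundedLaplacian, ← det_groundedLaplacian,
    groundedLaplacian_insert, groundedLaplacian_insert,
    det_updateRow_single_updateRow_single (isUnit_det_groundedLaplacian hx) huv]
  simp only [greenFunction_of_ne hu, greenFunction_of_ne hv]

theorem sum_mul_greenFunction_sub (φ : V → ℝ) :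
    ∑ e, (φ (s e) * (greenFunction s t x (s e) (s e) - greenFunction s t x (s e) (t e)) +
      φ (t e) * (greenFunction s t x (t e) (t e) - greenFunction s t x (s e) (t e))) =
      ∑ v ∈ univ.erase x, φ v := by
  have hterm (v : V) : ∑ e, incidence s t e v *
      (φ v * (greenFunction s t x (s e) v - greenFunction s t x (t e) v)) =
      if v = x then 0 else φ v := by
    split_ifs with hv
    · simp only [hv, greenFunction_right_self, sub_self, mul_zero, sum_const_zero]
    · simp only [mul_left_comm _ (φ v), ← mul_sum, sum_incidence_mul_greenFunction hx hv, if_true,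
        mul_one]
  calc _ = ∑ e, ∑ v, incidence s t e v *
        (φ v * (greenFunction s t x (s e) v - greenFunction s t x (t e) v)) := by
        refine sum_congr rfl fun e _ => ?_
        rw [← dotProduct, incidence_dotProduct, greenFunction_comm hx (t e) (s e)]
        ring
    _ = ∑ v, if v = x then 0 else φ v := by
        rw [sum_comm]
        exact sum_congr rfl fun v _ => hterm v
    _ = ∑ v ∈ univ.erase x, φ v := by
        rw [← filter_ne' univ x, sum_filter]
        exact sum_congr rfl fun v _ => (ite_not _ _ _).symm

theorem sum_effectiveResistance :
    ∑ e, effectiveResistance s t x e = (Fintype.card V : ℝ) - 1 := by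
  have h := sum_mul_greenFunction_sub hx fun _ => 1
  rw [sum_const, card_erase_of_mem (mem_univ x), card_univ, nsmul_one,
    Nat.cast_pred (Fintype.card_pos_iff.2 ⟨x⟩)] at h
  rw [← h]
  refine sum_congr rfl fun e _ => ?_
  rw [effectiveResistance]
  ring

theorem sum_effectiveResistance_sq_le :
    ∑ e, effectiveResistance s t x e ^ 2 ≤ 4 * (∑ v ∈ univ.erase x, greenFunction s t x v v -
      ∑ e, (greenFunction s t x (s e) (s e) * greenFunction s t x (t e) (t e) -
        greenFunction s t x (s e) (t e) ^ 2)) := by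
  rw [← sum_mul_greenFunction_sub hx fun v => greenFunction s t x v v, ← sum_sub_distrib, mul_sum]
  refine sum_le_sum fun e _ => ?_
  rw [effectiveResistance]
  linarith [sq_nonneg (greenFunction s t x (s e) (s e) - greenFunction s t x (t e) (t e))]

theorem card_twoForestFinset_eq_mul (hst : ∀ e, s e ≠ t e) :
    (#(twoForestFinset s t) : ℝ) = #(rootedForests s t univ {x}) *
      (∑ v ∈ univ.erase x, greenFunction s t x v v -
        ∑ e, (greenFunction s t x (s e) (s e) * greenFunction s t x (t e) (t e) -
          greenFunction s t x (s e) (t e) ^ 2)) := by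
  have hpairs : #(rootedForests s t univ {x}) * ∑ v ∈ univ.erase x, greenFunction s t x v v =
      ∑ v ∈ univ.erase x, (#(rootedForests s t univ {x, v}) : ℝ) := by
    rw [mul_sum]
    exact sum_congr rfl fun v hv => card_mul_greenFunction_self hx (ne_of_mem_erase hv)
  have htriples : #(rootedForests s t univ {x}) *
      ∑ e, (greenFunction s t x (s e) (s e) * greenFunction s t x (t e) (t e) -
        greenFunction s t x (s e) (t e) ^ 2) =
      ∑ e with s e ≠ x ∧ t e ≠ x, (#(rootedForests s t univ {x, s e, t e}) : ℝ) := by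
    rw [mul_sum, sum_filter]
    refine sum_congr rfl fun e _ => ?_
    split_ifs with he
    · exact card_mul_greenFunction_minor hx he.1 he.2 (hst e)
    · rcases not_and_or.1 he with he | he <;>
        simp [not_not.1 he, greenFunction_left_self hx, greenFunction_right_self]
  rw [mul_sub, hpairs, htriples, eq_sub_iff_add_eq]
  exact_mod_cast card_twoForestFinset_add_sum hst x

theorem card_sub_one_sq_mul_card_rootedForests_le (hst : ∀ e, s e ≠ t e) :
    ((Fintype.card V : ℝ) - 1) ^ 2 * #(rootedForests s t univ {x}) ≤
      4 * Fintype.card E * #(twoForestFinset s t) := by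
  rw [card_twoForestFinset_eq_mul hx hst, ← sum_effectiveResistance hx]
  calc (∑ e, effectiveResistance s t x e) ^ 2 * #(rootedForests s t univ {x})
      ≤ (Fintype.card E * ∑ e, effectiveResistance s t x e ^ 2) *
          #(rootedForests s t univ {x}) := by
        gcongr
        exact sq_sum_le_card_mul_sum_sq
    _ ≤ (Fintype.card E * (4 * _)) * #(rootedForests s t univ {x}) := by
        gcongr
        exact sum_effectiveResistance_sq_le hx
    _ = _ := by ring

end GreenFunction

section Multigraphs

variable {α β : Type*} {G F : Graph α β} {x y : α}

theorem Reachable.symm (h : Reachable G x y) : Reachable G y x :=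
  symm_of (ReflTransGen G.Adj) h

theorem setOf_reachable_eq_iff :
    {z | Reachable G x z} = {z | Reachable G y z} ↔ Reachable G x y := by
  refine ⟨fun h => ?_, fun h => Set.ext fun z => ⟨h.symm.trans, h.trans⟩⟩
  have hy : y ∈ {z | Reachable G y z} := .refl
  rwa [← h] at hy

theorem ncard_components_eq_two_iff : (components G).ncard = 2 ↔
    ∃ u ∈ G.vertexSet, ∃ v ∈ G.vertexSet, ¬ Reachable G u v ∧
      ∀ w ∈ G.vertexSet, Reachable G w u ∨ Reachable G w v := by
  rw [Set.ncard_eq_two]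
  constructor
  · rintro ⟨A, B, hAB, h⟩
    obtain ⟨u, hu, rfl⟩ : A ∈ components G := by simp [h]
    obtain ⟨v, hv, rfl⟩ : B ∈ components G := by simp [h]
    refine ⟨u, hu, v, hv, mt setOf_reachable_eq_iff.2 hAB, fun w hw => ?_⟩
    have hmem : {z | Reachable G w z} ∈ components G := ⟨w, hw, rfl⟩
    rw [h] at hmem
    exact hmem.imp setOf_reachable_eq_iff.1 setOf_reachable_eq_iff.1
  · rintro ⟨u, hu, v, hv, huv, h⟩
    refine ⟨_, _, mt setOf_reachable_eq_iff.1 huv, Set.Subset.antisymm ?_ ?_⟩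
    · rintro _ ⟨w, hw, rfl⟩
      exact (h w hw).imp setOf_reachable_eq_iff.2 setOf_reachable_eq_iff.2
    · rintro _ (rfl | rfl)
      exacts [⟨u, hu, rfl⟩, ⟨v, hv, rfl⟩]

theorem mem_cutSet_iff (hF : F.IsSpanningSubgraph G) {e : β} (he : G.IsLink e x y) :
    e ∈ cutSet G F ↔ ¬ Reachable F x y := by
  constructor
  · rintro ⟨_, ⟨a, -, rfl⟩, _, ⟨b, -, rfl⟩, hab, u, hu, v, hv, huv⟩ hxy
    have hj : Reachable F u v := by
      rcases he.eq_and_eq_or_eq_and_eq huv with ⟨rfl, rfl⟩ | ⟨rfl, rfl⟩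
      exacts [hxy, hxy.symm]
    exact hab (setOf_reachable_eq_iff.2 ((hu.trans hj).trans (Reachable.symm hv)))
  · exact fun h => ⟨_, ⟨x, hF.vertexSet_eq ▸ he.left_mem, rfl⟩,
      _, ⟨y, hF.vertexSet_eq ▸ he.right_mem, rfl⟩,
      mt setOf_reachable_eq_iff.1 h, x, .refl, y, .refl, he⟩

theorem Reachable.exists_path (h : Reachable G x y) :
    ∃ (n : ℕ) (v : ℕ → α), v 0 = x ∧ v n = y ∧ Set.InjOn v (Set.Iic n) ∧
      ∀ i < n, G.Adj (v i) (v (i + 1)) := by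
  have hr : (SimpleGraph.fromRel G.Adj).Reachable x y := by
    induction h with
    | refl => rfl
    | @tail b c _ hbc ih =>
      by_cases hne : b = c
      · exact hne ▸ ih
      · exact ih.trans (SimpleGraph.Adj.reachable ⟨hne, Or.inl hbc⟩)
  obtain ⟨p, hp⟩ := hr.exists_isPath
  refine ⟨p.length, p.getVert, p.getVert_zero, p.getVert_length, hp.getVert_injOn, fun i hi => ?_⟩
  exact (p.adj_getVert_succ hi).2.elim id Graph.Adj.symm

theorem hasCycle_of_path {n : ℕ} {v : ℕ → α} {f : ℕ → β} (hv : Set.InjOn v (Set.Iic n))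
    (hf : ∀ i < n, G.IsLink (f i) (v i) (v (i + 1))) (hlast : G.IsLink (f n) (v n) (v 0))
    (hne : ∀ i < n, f i ≠ f n) : HasCycle G := by
  have hinj (i j : ℕ) (hi : i ≤ n) (hj : j ≤ n) (h : f i = f j) : i = j := by
    rcases hi.eq_or_lt with rfl | hi' <;> rcases hj.eq_or_lt with rfl | hj'
    · rfl
    · exact absurd h.symm (hne j hj')
    · exact absurd h (hne i hi')
    · rcases (hf i hi').eq_and_eq_or_eq_and_eq (h ▸ hf j hj') with ⟨hij, -⟩ | ⟨hij, hji⟩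
      · exact hv hi hj hij
      · have := hv hi (Nat.succ_le_of_lt hj') hij
        have := hv (Nat.succ_le_of_lt hi') hj hji
        lia
  refine ⟨n, fun i => v i, fun i => f i,
    fun i j h => Fin.ext (hv (Fin.is_le i) (Fin.is_le j) h),
    fun i j h => Fin.ext (hinj i j (Fin.is_le i) (Fin.is_le j) h), fun i => ?_⟩
  rcases (Fin.le_last i).eq_or_lt with rfl | hi
  · simpa only [Fin.last_add_one, Fin.val_last, Fin.val_zero] using hlast
  · simpa only [Fin.val_add_one_of_lt hi] using hf i hi

theorem hasCycle_iff :
    HasCycle G ↔ ∃ e x y, G.IsLink e x y ∧ Reachable (G.deleteEdges {e}) x y := by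
  constructor
  · rintro ⟨n, v, f, -, hf, hl⟩
    have hreach (i : Fin (n + 1)) : Reachable (G.deleteEdges {f (Fin.last n)}) (v 0) (v i) := by
      induction i using Fin.induction with
      | zero => exact .refl
      | succ i ih =>
        have hi : f i.castSucc ≠ f (Fin.last n) := hf.ne i.castSucc_lt_last.ne
        refine ih.tail ⟨f i.castSucc, ?_⟩
        simpa [hi] using hl i.castSucc
    have hlast := hl (Fin.last n)
    rw [Fin.last_add_one] at hlast
    exact ⟨_, _, _, hlast, (hreach (Fin.last n)).symm⟩
  · rintro ⟨e, x, y, he, h⟩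
    obtain ⟨n, v, rfl, rfl, hv, hadj⟩ := h.exists_path
    have : Nonempty β := ⟨e⟩
    choose! f hf using hadj
    simp only [Graph.deleteEdges_isLink, Set.mem_singleton_iff] at hf
    refine hasCycle_of_path (f := Function.update f n e) hv (fun i hi => ?_) ?_ fun i hi => ?_
    · rw [Function.update_of_ne hi.ne]
      exact (hf i hi).1
    · rw [Function.update_self]
      exact he.symm
    · rw [Function.update_of_ne hi.ne, Function.update_self]
      exact (hf i hi).2

theorem setOf_inc_eq_pair {e : β} (he : G.IsLink e x y) : {v | G.Inc e v} = {x, y} := by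
  ext v
  refine ⟨fun h => h.eq_or_eq_of_isLink he, ?_⟩
  rintro (rfl | rfl)
  exacts [he.inc_left, he.inc_right]

theorem finsum_degree_eq [G.Loopless] (hV : G.vertexSet.Finite) (hE : G.edgeSet.Finite) :
    ∑ᶠ v ∈ G.vertexSet, degree G v = 2 * G.edgeSet.ncard := by
  classical
  calc ∑ᶠ v ∈ G.vertexSet, degree G v
      = ∑ v ∈ hV.toFinset, #{e ∈ hE.toFinset | G.Inc e v} := by
        rw [finsum_mem_eq_finite_toFinset_sum _ hV]
        refine sum_congr rfl fun v _ => ?_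
        rw [degree, ← Set.ncard_coe_finset]
        congr 1
        ext e
        simpa using Graph.Inc.edge_mem
    _ = ∑ e ∈ hE.toFinset, #{v ∈ hV.toFinset | G.Inc e v} :=
        sum_card_bipartiteAbove_eq_sum_card_bipartiteBelow fun v e => G.Inc e v
    _ = ∑ e ∈ hE.toFinset, 2 := by
        refine sum_congr rfl fun e he => ?_
        obtain ⟨x, y, hxy⟩ := G.exists_isLink_of_mem_edgeSet (hE.mem_toFinset.1 he)
        rw [← Set.ncard_pair hxy.ne, ← setOf_inc_eq_pair hxy, ← Set.ncard_coe_finset]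
        congr 1
        ext v
        simpa using Graph.Inc.vertex_mem
    _ = 2 * G.edgeSet.ncard := by
        rw [sum_const, smul_eq_mul, mul_comm, Set.ncard_eq_toFinset_card _ hE]

theorem avgDegree_eq [G.Loopless] (hV : G.vertexSet.Finite) (hE : G.edgeSet.Finite) :
    avgDegree G = 2 * (G.edgeSet.ncard : ℝ) / (G.vertexSet.ncard : ℝ) := by
  have h := finsum_degree_eq hV hE
  rw [finsum_mem_eq_finite_toFinset_sum _ hV] at h
  rw [avgDegree, finsum_mem_eq_finite_toFinset_sum _ hV]
  congr 1
  exact_mod_cast h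

end Multigraphs

section EdgeEnds

variable {α β : Type*} {G : Graph α β}

theorem exists_isLink_coe (e : G.edgeSet) : ∃ a b : G.vertexSet, G.IsLink e a b := by
  obtain ⟨a, b, h⟩ := G.exists_isLink_of_mem_edgeSet e.2
  exact ⟨⟨a, h.left_mem⟩, ⟨b, h.right_mem⟩, h⟩

/-- One end of the edge `e`, chosen arbitrarily; together with `target` it turns a multigraph into
the two end maps of `Link`. -/
noncomputable def source (e : G.edgeSet) : G.vertexSet := (exists_isLink_coe e).choose

/-- The end of `e` other than `source e`, or the same vertex if `e` is a loop. -/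
noncomputable def target (e : G.edgeSet) : G.vertexSet := (exists_isLink_coe e).choose_spec.choose

theorem isLink_source_target (e : G.edgeSet) : G.IsLink e (source e) (target e) :=
  (exists_isLink_coe e).choose_spec.choose_spec

theorem source_ne_target [G.Loopless] (e : G.edgeSet) : source e ≠ target e :=
  fun h => (isLink_source_target e).ne (congrArg Subtype.val h)

theorem link_source_target_iff {e : G.edgeSet} {a b : G.vertexSet} :
    Link source target e a b ↔ G.IsLink e a b := by
  simp only [(isLink_source_target e).isLink_iff, Link, Subtype.ext_iff]

variable (G) in
/-- The spanning subgraph of `G` with edge set `S`. -/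
def spanningSubgraph (S : Finset G.edgeSet) : Graph α β :=
  G.restrict (Subtype.val '' (S : Set G.edgeSet))

variable {S : Finset G.edgeSet} {e : G.edgeSet} {a b : G.vertexSet}

theorem spanningSubgraph_isSpanningSubgraph : (spanningSubgraph G S).IsSpanningSubgraph G where
  le := Graph.restrict_le
  vertexSet_eq := rfl

theorem edgeSet_spanningSubgraph :
    (spanningSubgraph G S).edgeSet = Subtype.val '' (S : Set G.edgeSet) := by
  rw [spanningSubgraph, Graph.edgeSet_restrict, Set.inter_eq_right]
  exact Subtype.coe_image_subset _ _

theorem spanningSubgraph_injective : Function.Injective (spanningSubgraph G) := fun S T h => by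
  have himage := congrArg Graph.edgeSet h
  rw [edgeSet_spanningSubgraph, edgeSet_spanningSubgraph] at himage
  exact coe_injective (Subtype.val_injective.image_injective himage)

theorem spanningSubgraph_univ [Fintype G.edgeSet] : spanningSubgraph G univ = G := by
  rw [spanningSubgraph, Graph.restrict_eq_self_iff]
  simp

theorem spanningSubgraph_erase [DecidableEq G.edgeSet] :
    spanningSubgraph G (S.erase e) = (spanningSubgraph G S).deleteEdges {e.1} := by
  refine (Graph.Compatible.of_le_le Graph.restrict_le
    (Graph.deleteEdges_le.trans Graph.restrict_le)).ext rfl ?_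
  simp [edgeSet_spanningSubgraph, Set.image_sdiff Subtype.val_injective]

theorem exists_spanningSubgraph_eq [Finite G.edgeSet] {F : Graph α β}
    (hF : F.IsSpanningSubgraph G) : ∃ S, spanningSubgraph G S = F := by
  refine ⟨(Set.toFinite {e : G.edgeSet | e.1 ∈ F.edgeSet}).toFinset,
    (Graph.Compatible.of_le_le Graph.restrict_le hF.le).ext hF.vertexSet_eq.symm ?_⟩
  rw [edgeSet_spanningSubgraph, Set.Finite.coe_toFinset]
  exact Subtype.image_preimage_coe _ _ |>.trans (Set.inter_eq_right.2 hF.le.edgeSet_mono)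

theorem isLink_spanningSubgraph_iff :
    (spanningSubgraph G S).IsLink e a b ↔ e ∈ S ∧ Link source target e a b := by
  simp [spanningSubgraph, link_source_target_iff]

theorem adj_spanningSubgraph_iff :
    (spanningSubgraph G S).Adj a b ↔ ∃ e ∈ S, Link source target e a b := by
  simp only [← isLink_spanningSubgraph_iff]
  exact ⟨fun ⟨e, he⟩ => ⟨⟨e, Graph.restrict_le.edgeSet_mono he.edge_mem⟩, he⟩,
    fun ⟨e, he⟩ => ⟨e, he⟩⟩

theorem reachable_spanningSubgraph_iff :
    Reachable (spanningSubgraph G S) a b ↔ JoinedBy source target S a b := by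
  constructor
  · suffices ∀ c, Reachable (spanningSubgraph G S) a c →
        ∃ hc, JoinedBy source target S a ⟨c, hc⟩ from fun h => (this b h).2
    intro c h
    induction h with
    | refl => exact ⟨a.2, .refl⟩
    | tail _ hl ih =>
      obtain ⟨hc, hj⟩ := ih
      have hd := hl.right_mem
      exact ⟨hd, hj.tail (adj_spanningSubgraph_iff (a := ⟨_, hc⟩) (b := ⟨_, hd⟩).1 hl)⟩
  · exact fun h => h.lift Subtype.val fun _ _ => adj_spanningSubgraph_iff.2

theorem hasCycle_spanningSubgraph_iff [DecidableEq G.edgeSet] :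
    HasCycle (spanningSubgraph G S) ↔
      ∃ e ∈ S, JoinedBy source target (S.erase e) (source e) (target e) := by
  simp only [hasCycle_iff, ← reachable_spanningSubgraph_iff, spanningSubgraph_erase]
  constructor
  · rintro ⟨e, x, y, he, h⟩
    have he' := he.edge_mem
    rw [edgeSet_spanningSubgraph] at he'
    obtain ⟨e, heS, rfl⟩ := he'
    refine ⟨e, heS, ?_⟩
    have hl : G.IsLink e x y := he.mono Graph.restrict_le
    rcases hl.eq_and_eq_or_eq_and_eq (isLink_source_target e) with ⟨rfl, rfl⟩ | ⟨rfl, rfl⟩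
    exacts [h, h.symm]
  · rintro ⟨e, he, h⟩
    exact ⟨e, _, _, isLink_spanningSubgraph_iff.2 ⟨he, link_ends e⟩, h⟩

theorem mem_cutSet_spanningSubgraph_iff :
    e.1 ∈ cutSet G (spanningSubgraph G S) ↔ ¬ JoinedBy source target S (source e) (target e) := by
  rw [mem_cutSet_iff spanningSubgraph_isSpanningSubgraph (isLink_source_target e),
    reachable_spanningSubgraph_iff]

variable [Fintype G.vertexSet] [DecidableEq G.vertexSet]

theorem spanningSubgraph_mem_twoForests_iff :
    spanningSubgraph G S ∈ twoForests G ↔ IsTwoForest source target S := by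
  classical
  have hcomp : (components (spanningSubgraph G S)).ncard = 2 ↔
      ∃ u v, ¬ JoinedBy source target S u v ∧
        ∀ w, JoinedBy source target S w u ∨ JoinedBy source target S w v := by
    rw [ncard_components_eq_two_iff, spanningSubgraph_isSpanningSubgraph.vertexSet_eq]
    simp only [← reachable_spanningSubgraph_iff, Subtype.exists, Subtype.forall, exists_prop]
  simp only [twoForests, Set.mem_ofPred_eq, spanningSubgraph_isSpanningSubgraph, true_and, hcomp,
    isTwoForest_iff, hasCycle_spanningSubgraph_iff, not_exists, not_and]
  exact and_comm

end EdgeEnds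

section ExpectedCutSize

variable {α β : Type*} {G : Graph α β}

theorem twoForests_eq_image [Fintype G.vertexSet] [DecidableEq G.vertexSet] [Fintype G.edgeSet] :
    twoForests G = spanningSubgraph G '' (twoForestFinset (source (G := G)) target) := by
  ext F
  constructor
  · intro hF
    obtain ⟨S, rfl⟩ := exists_spanningSubgraph_eq hF.1
    exact ⟨S, mem_twoForestFinset.2 (spanningSubgraph_mem_twoForests_iff.1 hF), rfl⟩
  · rintro ⟨S, hS, rfl⟩
    exact spanningSubgraph_mem_twoForests_iff.2 (mem_twoForestFinset.1 hS)

theorem ncard_cutSet_spanningSubgraph [Fintype G.edgeSet] (S : Finset G.edgeSet) :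
    (cutSet G (spanningSubgraph G S)).ncard =
      #{e | ¬ JoinedBy source target S (source e) (target e)} := by
  rw [← Set.ncard_coe_finset, ← Set.ncard_image_of_injective _ Subtype.val_injective]
  congr 1
  ext e
  constructor
  · intro he
    obtain ⟨-, -, -, -, -, u, -, v, -, hl⟩ := id he
    exact ⟨⟨e, hl.edge_mem⟩, by simpa using mem_cutSet_spanningSubgraph_iff.1 he, rfl⟩
  · rintro ⟨e, he, rfl⟩
    exact mem_cutSet_spanningSubgraph_iff.2 (by simpa using he)

theorem expectedCutSize_eq_div [Fintype G.vertexSet] [DecidableEq G.vertexSet] [Fintype G.edgeSet]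
    [G.Loopless] (x : G.vertexSet) : expectedCutSize G =
      ((Fintype.card G.vertexSet - 1) * #(rootedForests source target univ {x}) : ℕ) /
        (#(twoForestFinset (source (G := G)) target) : ℝ) := by
  classical
  rw [expectedCutSize, twoForests_eq_image, finsum_mem_image spanningSubgraph_injective.injOn,
    finsum_mem_coe_finset, Set.ncard_image_of_injective _ spanningSubgraph_injective,
    Set.ncard_coe_finset, ← sum_card_not_joinedBy_twoForestFinset source_ne_target, Nat.cast_sum]
  simp only [ncard_cutSet_spanningSubgraph]

theorem Connected.spans_univ [Fintype G.edgeSet] (h : Connected G) {R : Finset G.vertexSet}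
    (hR : R.Nonempty) : Spans source target univ R := fun v => by
  obtain ⟨r, hr⟩ := hR
  refine ⟨r, hr, reachable_spanningSubgraph_iff.1 ?_⟩
  rw [spanningSubgraph_univ]
  exact h.2 v v.2 r r.2

theorem Connected.twoForestFinset_nonempty [Fintype G.vertexSet] [DecidableEq G.vertexSet]
    [Fintype G.edgeSet] [Nontrivial G.vertexSet] (h : Connected G) :
    (twoForestFinset (source (G := G)) target).Nonempty := by
  obtain ⟨x, y, hxy⟩ := exists_pair_ne G.vertexSet
  obtain ⟨F, -, hF⟩ := (h.spans_univ (insert_nonempty x {y})).exists_isRootedForest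
  exact ⟨F, mem_twoForestFinset.2 ⟨x, y, hxy, hF⟩⟩

theorem Connected.twoForests_nonempty (h : Connected G) (hE : G.edgeSet.Finite)
    (hcard : 2 ≤ G.vertexSet.ncard) : (twoForests G).Nonempty := by
  classical
  obtain ⟨hnontrivial, hV⟩ := Set.one_lt_ncard_iff_nontrivial_and_finite.1 hcard
  have := hnontrivial.coe_sort
  have := hV.fintype
  have := hE.fintype
  rw [twoForests_eq_image]
  exact (coe_nonempty.2 h.twoForestFinset_nonempty).image _

theorem Connected.expectedCutSize_le [G.Loopless] (h : Connected G) (hE : G.edgeSet.Finite)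
    (hcard : 2 ≤ G.vertexSet.ncard) :
    expectedCutSize G ≤ 4 * G.edgeSet.ncard / ((G.vertexSet.ncard : ℝ) - 1) := by
  classical
  obtain ⟨hnontrivial, hV⟩ := Set.one_lt_ncard_iff_nontrivial_and_finite.1 hcard
  have := hnontrivial.coe_sort
  have := hV.fintype
  have := hE.fintype
  have hn : (0 : ℝ) < G.vertexSet.ncard - 1 := sub_pos.2 (by exact_mod_cast hcard)
  obtain ⟨x⟩ : Nonempty G.vertexSet := inferInstance
  obtain ⟨T, hT⟩ := (h.spans_univ (singleton_nonempty x)).exists_isRootedForest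
  have hbound := card_sub_one_sq_mul_card_rootedForests_le ⟨T, mem_rootedForests.2 hT⟩
    (source_ne_target (G := G))
  rw [← Nat.card_eq_fintype_card, ← Nat.card_eq_fintype_card, Nat.card_coe_set_eq,
    Nat.card_coe_set_eq] at hbound
  rw [expectedCutSize_eq_div x, ← Nat.card_eq_fintype_card, Nat.card_coe_set_eq, Nat.cast_mul,
    Nat.cast_pred (by lia), div_le_div_iff₀ (by exact_mod_cast h.twoForestFinset_nonempty.card_pos)
    hn]
  linarith

end ExpectedCutSize

end TwoForest

theorem theoremB {α β : Type*} (G : Graph α β) [G.Loopless]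
    (hV : G.vertexSet.Finite) (hE : G.edgeSet.Finite)
    (hconn : TwoForest.Connected G) (hcard : 2 ≤ G.vertexSet.ncard) :
    (TwoForest.twoForests G).Nonempty ∧
    TwoForest.avgDegree G = 2 * (G.edgeSet.ncard : ℝ) / (G.vertexSet.ncard : ℝ) ∧
    TwoForest.expectedCutSize G ≤
      2 * TwoForest.avgDegree G * (1 + 1 / ((G.vertexSet.ncard : ℝ) - 1)) := by
  have havg := TwoForest.avgDegree_eq hV hE
  refine ⟨hconn.twoForests_nonempty hE hcard, havg, ?_⟩
  have hn : (2 : ℝ) ≤ G.vertexSet.ncard := by exact_mod_cast hcard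
  have hn0 : (G.vertexSet.ncard : ℝ) ≠ 0 := by linarith
  have hn1 : (G.vertexSet.ncard : ℝ) - 1 ≠ 0 := by linarith
  calc TwoForest.expectedCutSize G
      ≤ 4 * G.edgeSet.ncard / ((G.vertexSet.ncard : ℝ) - 1) :=
        hconn.expectedCutSize_le hE hcard
    _ = 2 * TwoForest.avgDegree G * (1 + 1 / ((G.vertexSet.ncard : ℝ) - 1)) := by
        rw [havg]
        field_simp
        ring
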